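/- Let $\mathcal A$ be a finite alphabet and let $X\subseteq\mathcal A^{\mathbb Z}$ be a minimal shift space (a non-empty, closed, shift-invariant set containing no other shift space strictly) such that every letter of $\mathcal A$ occurs in the set $\mathcal L(X)$ of finite words appearing in elements of $X$. For $u\in\mathcal L(X)$ let $\mathcal R_X(u)$ be the set of return words to $u$, i.e. of non-empty words $r$ such that $ru\in\mathcal L(X)\cap(u\mathcal A^*\setminus\mathcal A^+u\mathcal A^+)$, and let $\langle\mathcal R_X(u)\rangle$ be the subgroup that they generate in the free group $F_{\mathcal A}$. For a group morphism $\varphi\colon F_{\mathcal A}\to G$, $X$ has $\varphi$-stable return groups if $\varphi\langle\mathcal R_X(u)\rangle=\varphi\langle\mathcal R_X(\varepsilon)\rangle$ for all $u\in\mathcal L(X)$. For $x\in\mathcal A^{\mathbb Z}$ and $w\in\mathcal L(x)$ let $P_x(w)=\{x_{[0,m)}\mid m\in\mathbb Z,\ x_{[m,m+|w|)}=w\}\subseteq F_{\mathcal A}$, where $x_{[0,m)}=x_{[m,0)}^{-1}$ if $m<0$; $X$ has $\varphi$-welldoc if $\varphi(P_x(w))=\varphi(F_{\mathcal A})$ for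 all $x\in X$ and $w\in\mathcal L(x)$. Let $\operatorname{ab}\colon F_{\mathcal A}\to\mathbb Z^{\mathcal A}$, $u\mapsto(|u|_a)_{a\in\mathcal A}$, be the abelianization (where $a^{-1}$ counts as a negative occurrence of $a$), and let $\operatorname{ab}_k\colon F_{\mathcal A}\to(\mathbb Z/k\mathbb Z)^{\mathcal A}$ be its reduction modulo $k$. A one-sided word $y\in\mathcal A^{\mathbb N}$ has the welldoc property of Balková et al. if $\operatorname{ab}_k\{y_{[0,m)}\mid m\in\mathbb N,\ y_{[m,m+|w|)}=w\}=(\mathbb Z/k\mathbb Z)^{\mathcal A}$ for all $k\ge1$ and all $w\in\mathcal L(y)$. A group $G$ is subgroup separable if for every finitely generated subgroup $H\le G$ and every $g\in G\setminus H$ there is a normal subgroup $N\trianglelefteq G$ of finite index such that the image of $g$ in $G/N$ is not in the image of $H$. Then: 1. $X$ has $\operatorname{ab}$-stable return groups if and only if $X$ has $\operatorname{ab}_k$-welldoc for all integers $k\ge1$. 2. For every $y\in\mathcal A^{\mathbb N}$ with $\mathcal L(y)=\mathcal L(X)$, $X$ has $\operatorname{ab}$-stable return groups if and only if $y$ has the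 welldoc property of Balková et al. 3. For every morphism $\varphi$ from $F_{\mathcal A}$ onto a subgroup separable group $G$, $X$ has $\varphi$-stable return groups if and only if $X$ has $\psi$-welldoc for every morphism $\psi$ from $F_{\mathcal A}$ onto a finite group $H$ with $\ker\varphi\subseteq\ker\psi$. -/

import Mathlib

namespace ReturnGroups

universe u v

/-! ### Words, languages, shift spaces -/

section Words

variable {A : Type u}

/-- The word `x_{[i, i+n)} = x_i x_{i+1} ⋯ x_{i+n-1}`, for a two-sided (`ι = ℤ`) or a one-sided
(`ι = ℕ`) infinite word `x`. -/
def factor {ι : Type} [Add ι] [NatCast ι] (x : ι → A) (i : ι) (n : ℕ) : List A :=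
  (List.range n).map fun j => x (i + (j : ι))

/-- The language `ℒ(x)` of an infinite word `x`: the set of all finite words occurring in `x`. -/
def language {ι : Type} [Add ι] [NatCast ι] (x : ι → A) : Set (List A) :=
  {w | ∃ i : ι, factor x i w.length = w}

/-- The language `ℒ(X)` of a set of two-sided infinite words. -/
def shiftLanguage (X : Set (ℤ → A)) : Set (List A) :=
  ⋃ x ∈ X, language x

/-- The shift map `(x_n)_n ↦ (x_{n+1})_n` on two-sided infinite words. -/
def shift (x : ℤ → A) : ℤ → A := fun n => x (n + 1)

/-- A shift space: a non-empty closed shift-invariant set of two-sided infinite words. -/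
structure IsShiftSpace [TopologicalSpace A] (X : Set (ℤ → A)) : Prop where
  nonempty : X.Nonempty
  isClosed : IsClosed X
  invariant : shift '' X = X

/-- A minimal shift space: a shift space that strictly contains no other shift space. -/
structure IsMinimalShiftSpace [TopologicalSpace A] (X : Set (ℤ → A)) : Prop where
  isShiftSpace : IsShiftSpace X
  minimal : ∀ Y : Set (ℤ → A), IsShiftSpace Y → Y ⊆ X → Y = X

/-- The set `ℛ_X(u)` of return words to `u` in `X`: the non-empty words `r` such that
`ru ∈ ℒ(X) ∩ (uA* ∖ A⁺uA⁺)`. -/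
def returnWords (X : Set (ℤ → A)) (u : List A) : Set (List A) :=
  {r | r ≠ [] ∧ r ++ u ∈ shiftLanguage X ∧ u <+: r ++ u ∧
    ¬ ∃ p s : List A, p ≠ [] ∧ s ≠ [] ∧ r ++ u = p ++ u ++ s}

/-- The canonical embedding of the free monoid into the free group. -/
def toFreeGroup (w : List A) : FreeGroup A := (w.map FreeGroup.of).prod

/-- The return group to `w` in `X`: the subgroup of the free group generated by the return words
to `w`. -/
def returnGroup (X : Set (ℤ → A)) (w : List A) : Subgroup (FreeGroup A) :=
  Subgroup.closure (toFreeGroup '' returnWords X w)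

end Words

/-! ### Stability -/

section Stability

variable {A : Type u} {G : Type v} [Group G]

/-- For all `w ∈ ℒ(X)` of length `M` and all `u ∈ wA* ∩ ℒ(X)`, the return groups to `u` and to `w`
have the same image under `φ`. -/
def IsStableFrom (X : Set (ℤ → A)) (φ : FreeGroup A →* G) (M : ℕ) : Prop :=
  ∀ w ∈ shiftLanguage X, w.length = M → ∀ u ∈ shiftLanguage X, w <+: u →
    (returnGroup X u).map φ = (returnGroup X w).map φ

/-- `X` has `φ`-stable return groups: eventual `φ`-stability with `M = 0`. -/
def HasStableReturnGroups (X : Set (ℤ → A)) (φ : FreeGroup A →* G) : Prop :=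
  IsStableFrom X φ 0

/-- `G` is `H`-separable: every `g ∉ H` stays outside the image of `H` in some finite quotient
`G ⧸ N`. -/
def IsSeparableSubgroup (H : Subgroup G) : Prop :=
  ∀ g : G, g ∉ H → ∃ (N : Subgroup G) (_ : N.Normal), N.FiniteIndex ∧
    QuotientGroup.mk' N g ∉ H.map (QuotientGroup.mk' N)

variable (G) in
/-- Subgroup separable (LERF) groups: `H`-separable for all finitely generated `H ≤ G`. -/
def IsSubgroupSeparable : Prop :=
  ∀ H : Subgroup G, H.FG → IsSeparableSubgroup H

end Stability

/-! ### Well distributed occurrences -/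

section Welldoc

variable {A : Type u} {G : Type v} [Group G]

/-- The element `x_{[i,j)}` of the free group, with `x_{[i,j)} = x_{[j,i)}⁻¹` when `j < i`. -/
def freeSegment (x : ℤ → A) (i j : ℤ) : FreeGroup A :=
  if i ≤ j then toFreeGroup (factor x i (j - i).toNat)
  else (toFreeGroup (factor x j (i - j).toNat))⁻¹

/-- `P_x(w) = {x_{[0,m)} | m ∈ ℤ, x_{[m,m+|w|)} = w}` for a two-sided infinite word `x`. -/
def occ (x : ℤ → A) (w : List A) : Set (FreeGroup A) :=
  {g | ∃ m : ℤ, factor x m w.length = w ∧ g = freeSegment x 0 m}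

/-- `P_y(w) = {y_{[0,m)} | m ∈ ℕ, y_{[m,m+|w|)} = w}` for a one-sided infinite word `y`. -/
def occOneSided (y : ℕ → A) (w : List A) : Set (FreeGroup A) :=
  {g | ∃ m : ℕ, factor y m w.length = w ∧ g = toFreeGroup (factor y 0 m)}

/-- `X` has `φ`-welldoc: `φ(P_x(w)) = φ(F_A)` for every `x ∈ X` and every `w ∈ ℒ(x)`. -/
def HasWelldoc (X : Set (ℤ → A)) (φ : FreeGroup A →* G) : Prop :=
  ∀ x ∈ X, ∀ w ∈ language x, φ '' occ x w = Set.range φ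

end Welldoc

/-! ### Abelianization -/

section Abelianization

open Classical in
/-- The abelianization `F_A → ℤ^A`, `u ↦ (|u|_a)_a`, with `a⁻¹` counting as a negative occurrence:
the morphism sending each letter to the corresponding standard basis vector. -/
noncomputable def ab (A : Type u) : FreeGroup A →* Multiplicative (A → ℤ) :=
  FreeGroup.lift fun b => Multiplicative.ofAdd (Pi.single b 1)

/-- The `k`-abelianization `F_A → (ℤ/kℤ)^A`, `u ↦ (|u|_a + kℤ)_a`. -/
noncomputable def abMod (A : Type u) (k : ℕ) : FreeGroup A →* Multiplicative (A → ZMod k) :=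
  (AddMonoidHom.toMultiplicative
    ((Int.castAddHom (ZMod k)).compLeft A)).comp (ab A)

open Classical in
theorem ab_toFreeGroup {A : Type u} (w : List A) (a : A) :
    Multiplicative.toAdd (ab A (toFreeGroup w)) a = (w.count a : ℤ) := by
  induction w with
  | nil => simp [toFreeGroup]
  | cons b w ih =>
    have h : toFreeGroup (b :: w) = FreeGroup.of b * toFreeGroup w := by simp [toFreeGroup]
    rw [h, map_mul, toAdd_mul, Pi.add_apply, ih, List.count_cons, ab, FreeGroup.lift_apply_of,
      toAdd_ofAdd, Pi.single_apply]
    by_cases hb : b = a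
    · subst hb
      simp [add_comm]
    · simp [hb, Ne.symm hb]

theorem abMod_apply {A : Type u} (k : ℕ) (g : FreeGroup A) (a : A) :
    Multiplicative.toAdd (abMod A k g) a = ((Multiplicative.toAdd (ab A g) a : ℤ) : ZMod k) := rfl

/-- The welldoc property of a one-sided infinite word `y`, in its original form: for all `k ≥ 1`
and `w ∈ ℒ(y)`, `ab_k(P_y(w)) = (ℤ/kℤ)^A`. -/
def HasOneSidedWelldoc {A : Type u} (y : ℕ → A) : Prop :=
  ∀ k : ℕ, 1 ≤ k → ∀ w ∈ language y, abMod A k '' occOneSided y w = Set.univ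

end Abelianization

end ReturnGroups

open ReturnGroups

universe u v w

/-! All letters occur, so the return group to the empty word is `F_A`, and `φ`-stability says that
every return group has full image under `φ` (`hasStableReturnGroups_iff`).

For a finite target this is equivalent to welldoc. Two occurrences of `u` in a word are joined by an
element of the return group to `u`, so the prefixes leading to `u` lie in one left coset of that
group; if they hit the whole image, the group has full image. Conversely, a maximality argument
(`exists_word_hitting_range`) gives a finite word in which the occurrences of `u` already realize
every value; it occurs in each `x ∈ X` and in `y`.

It remains to recover full image in an infinite group from its finite quotients: in `ℤ^A` by a
divisibility argument, in a subgroup separable group because return groups are finitely generated,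
by uniform recurrence. -/

open scoped Pointwise

namespace ReturnGroups

/-! ### Factors and segments of infinite words -/

section Factors

variable {A : Type u}

theorem toFreeGroup_append (p q : List A) :
    toFreeGroup (p ++ q) = toFreeGroup p * toFreeGroup q := by
  simp [toFreeGroup]

theorem factor_eq {ι : Type} [Add ι] [NatCast ι] (x : ι → A) (i : ι) (n : ℕ) :
    factor x i n = (List.range n).map fun j : ℕ => x (i + (j : ι)) := by
  simp [factor, ← List.map_eq_flatMap]

theorem length_factor {ι : Type} [Add ι] [NatCast ι] (x : ι → A) (i : ι) (n : ℕ) :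
    (factor x i n).length = n := by
  simp [factor]

theorem factor_add {ι : Type} [AddMonoidWithOne ι] (x : ι → A) (i : ι) (m n : ℕ) :
    factor x i (m + n) = factor x i m ++ factor x (i + m) n := by
  simp [factor_eq, List.range_add, add_assoc]

theorem factor_one {ι : Type} [AddMonoidWithOne ι] (x : ι → A) (i : ι) :
    factor x i 1 = [x i] := by
  simp [factor]

theorem factor_append {ι : Type} [AddMonoidWithOne ι] {x : ι → A} {i : ι} {p q : List A}
    (h : factor x i (p ++ q).length = p ++ q) :
    factor x i p.length = p ∧ factor x (i + (p.length : ι)) q.length = q := by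
  rw [List.length_append, factor_add] at h
  exact List.append_inj h (length_factor _ _ _)

theorem factor_shift (x : ℤ → A) (i : ℤ) (n : ℕ) :
    factor (shift x) i n = factor x (i + 1) n := by
  simp [factor, shift, add_right_comm]

theorem mem_shiftLanguage {X : Set (ℤ → A)} {u : List A} :
    u ∈ shiftLanguage X ↔ ∃ x ∈ X, ∃ i : ℤ, factor x i u.length = u := by
  simp [shiftLanguage, language]

theorem mem_shiftLanguage_of_append {X : Set (ℤ → A)} {p q : List A}
    (h : p ++ q ∈ shiftLanguage X) : p ∈ shiftLanguage X ∧ q ∈ shiftLanguage X := by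
  obtain ⟨x, hx, i, hi⟩ := mem_shiftLanguage.1 h
  obtain ⟨h₁, h₂⟩ := factor_append hi
  exact ⟨mem_shiftLanguage.2 ⟨x, hx, i, h₁⟩, mem_shiftLanguage.2 ⟨x, hx, _, h₂⟩⟩

theorem freeSegment_add_one (x : ℤ → A) (m : ℤ) :
    freeSegment x 0 (m + 1) = freeSegment x 0 m * FreeGroup.of (x m) := by
  rcases le_or_gt 0 m with hm | hm
  · obtain ⟨n, rfl⟩ := Int.eq_ofNat_of_zero_le hm
    rw [freeSegment, freeSegment, if_pos (by omega), if_pos hm,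
      show ((n : ℤ) + 1 - 0).toNat = n + 1 by omega, show ((n : ℤ) - 0).toNat = n by omega,
      factor_add, toFreeGroup_append, factor_one]
    simp [toFreeGroup]
  · obtain ⟨n, rfl⟩ : ∃ n : ℕ, m = -(n : ℤ) - 1 := ⟨(-m - 1).toNat, by omega⟩
    have h₁ : freeSegment x 0 (-(n : ℤ) - 1 + 1) = (toFreeGroup (factor x (-(n : ℤ)) n))⁻¹ := by
      -- For `n = 0` the endpoint is `0`, which falls in the other branch of `freeSegment`.
      rcases n with _ | n
      · simp [freeSegment, factor, toFreeGroup]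
      · rw [freeSegment, if_neg (by omega)]
        congr 3
        omega
    rw [h₁, freeSegment, if_neg (by omega),
      show (0 - (-(n : ℤ) - 1)).toNat = 1 + n by omega, factor_add, toFreeGroup_append, factor_one]
    simp [toFreeGroup]

theorem freeSegment_add (x : ℤ → A) (m : ℤ) (n : ℕ) :
    freeSegment x 0 (m + n) = freeSegment x 0 m * toFreeGroup (factor x m n) := by
  induction n with
  | zero => simp [factor, toFreeGroup]
  | succ n ih =>
    rw [Nat.cast_succ, ← add_assoc, freeSegment_add_one, ih, factor_add, toFreeGroup_append,
      factor_one, mul_assoc]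
    simp [toFreeGroup]

end Factors

/-! ### Minimality and uniform recurrence -/

section Recurrence

variable {A : Type u} [TopologicalSpace A] [DiscreteTopology A] {X : Set (ℤ → A)}

theorem isClopen_setOf_factor_eq (i : ℤ) (u : List A) :
    IsClopen {x : ℤ → A | factor x i u.length = u} := by
  induction u generalizing i with
  | nil => simpa [factor] using isClopen_univ
  | cons a u ih =>
    have h : {x : ℤ → A | factor x i (a :: u).length = a :: u} =
        {x | x i = a} ∩ {x | factor x (i + 1) u.length = u} := by
      ext x
      rw [List.length_cons, add_comm]
      simp [factor_add, factor_one]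
    rw [h]
    exact ((isClopen_discrete {a}).preimage (continuous_apply i)).inter (ih _)

/-- The points of `X` avoiding `u` are closed and shift-invariant; if there were any, minimality
would make them all of `X`. -/
theorem IsMinimalShiftSpace.mem_language (hX : IsMinimalShiftSpace X) {u : List A}
    (hu : u ∈ shiftLanguage X) {x : ℤ → A} (hx : x ∈ X) : u ∈ language x := by
  by_contra hux
  let Y : Set (ℤ → A) := {z ∈ X | ∀ i, factor z i u.length ≠ u}
  have hY : IsShiftSpace Y := by
    refine ⟨⟨x, hx, fun i hi => hux ⟨i, hi⟩⟩, ?_, ?_⟩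
    · have : Y = X ∩ ⋂ i, {z : ℤ → A | factor z i u.length = u}ᶜ := by
        ext z
        simp [Y]
      rw [this]
      exact hX.isShiftSpace.isClosed.inter
        (isClosed_iInter fun i => (isClopen_setOf_factor_eq i u).compl.isClosed)
    · ext z
      constructor
      · rintro ⟨z, ⟨hz, hzu⟩, rfl⟩
        refine ⟨hX.isShiftSpace.invariant ▸ Set.mem_image_of_mem _ hz, fun i => ?_⟩
        rw [factor_shift]
        exact hzu _
      · rintro ⟨hz, hzu⟩
        rw [← hX.isShiftSpace.invariant] at hz
        obtain ⟨t, ht, rfl⟩ := hz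
        refine ⟨t, ⟨ht, fun i => ?_⟩, rfl⟩
        have := hzu (i - 1)
        rwa [factor_shift, sub_add_cancel] at this
  have hYX : Y = X := hX.minimal Y hY fun z hz => hz.1
  obtain ⟨z, hz, i, hi⟩ := mem_shiftLanguage.1 hu
  rw [← hYX] at hz
  exact hz.2 i hi

theorem IsMinimalShiftSpace.language_eq (hX : IsMinimalShiftSpace X) {x : ℤ → A} (hx : x ∈ X) :
    language x = shiftLanguage X :=
  Set.Subset.antisymm (Set.subset_biUnion_of_mem hx) fun _ hu => hX.mem_language hu hx

omit [DiscreteTopology A] in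
theorem IsShiftSpace.exists_factor_shift (hX : IsShiftSpace X) {x : ℤ → A} (hx : x ∈ X) (k : ℤ) :
    ∃ z ∈ X, ∀ i n, factor z i n = factor x (i + k) n := by
  induction k with
  | zero => exact ⟨x, hx, by simp⟩
  | succ k ih =>
    obtain ⟨z, hz, h⟩ := ih
    exact ⟨shift z, hX.invariant ▸ Set.mem_image_of_mem _ hz, fun i n => by
      rw [factor_shift, h]; congr 1; ring⟩
  | pred k ih =>
    obtain ⟨z, hz, h⟩ := ih
    rw [← hX.invariant] at hz
    obtain ⟨t, ht, rfl⟩ := hz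
    refine ⟨t, ht, fun i n => ?_⟩
    have := h (i - 1) n
    rw [factor_shift, sub_add_cancel] at this
    rw [this]; congr 1; ring

variable [Finite A]

/-- Uniform recurrence: every word of a minimal shift occurs with bounded gaps. -/
theorem IsMinimalShiftSpace.exists_bounded_gap (hX : IsMinimalShiftSpace X) {u : List A}
    (hu : u ∈ shiftLanguage X) :
    ∃ M : ℕ, ∀ x ∈ X, ∀ k : ℤ, ∃ j : ℤ, k ≤ j ∧ j ≤ k + M ∧ factor x j u.length = u := by
  have hc : IsCompact X := hX.isShiftSpace.isClosed.isCompact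
  obtain ⟨t, ht⟩ := hc.elim_finite_subcover (fun i : ℤ => {x : ℤ → A | factor x i u.length = u})
    (fun i => (isClopen_setOf_factor_eq i u).isOpen) fun x hx => by
      obtain ⟨i, hi⟩ := hX.mem_language hu hx
      exact Set.mem_iUnion.2 ⟨i, hi⟩
  obtain ⟨N, hN⟩ : ∃ N : ℕ, ∀ i ∈ t, i.natAbs ≤ N :=
    ⟨t.sup Int.natAbs, fun i hi => Finset.le_sup (f := Int.natAbs) hi⟩
  refine ⟨2 * N, fun x hx k => ?_⟩
  -- By compactness `u` occurs in every point at a position in `[-N, N]`; shifting by `k + N` moves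
  -- this window to `[k, k + 2N]`.
  obtain ⟨z, hz, h⟩ := hX.isShiftSpace.exists_factor_shift hx (k + N)
  obtain ⟨i, hit, hi⟩ := Set.mem_iUnion₂.1 (ht hz)
  have := hN i hit
  refine ⟨i + (k + N), by omega, by push_cast; omega, ?_⟩
  rw [← h]
  exact hi

/-- If `r` is longer than the gap bound plus one, then `ru` has an occurrence of `u` strictly
inside. -/
theorem IsMinimalShiftSpace.finite_returnWords (hX : IsMinimalShiftSpace X) {u : List A}
    (hu : u ∈ shiftLanguage X) : (returnWords X u).Finite := by
  obtain ⟨M, hM⟩ := hX.exists_bounded_gap hu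
  refine (List.finite_length_le A (M + 1)).subset ?_
  rintro r ⟨-, hr, -, hru⟩
  by_contra hlen
  replace hlen : M + 1 < r.length := by simpa using hlen
  obtain ⟨x, hx, i, hi⟩ := mem_shiftLanguage.1 hr
  obtain ⟨j, hj₁, hj₂, hj⟩ := hM x hx (i + 1)
  obtain ⟨a, ha⟩ := Int.eq_ofNat_of_zero_le (show 0 ≤ j - i by omega)
  obtain ⟨b, hb⟩ := Nat.exists_eq_add_of_le (show a ≤ r.length by omega)
  obtain rfl : j = i + a := by omega
  refine hru ⟨factor x i a, factor x (i + a + u.length) b, ?_, ?_, ?_⟩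
  · rw [← List.length_pos_iff, length_factor]; omega
  · rw [← List.length_pos_iff, length_factor]; omega
  · rw [← hi, List.length_append, hb, add_assoc, factor_add, add_comm b, factor_add, hj,
      List.append_assoc]

end Recurrence

/-! ### Return groups and their images -/

section ReturnGroup

variable {A : Type u} {X : Set (ℤ → A)}

/-- Cutting `ru` at an inner occurrence of `u` splits `r` into two shorter words of the same kind,
until only return words remain. -/
theorem toFreeGroup_mem_returnGroup {u : List A} (r : List A) (hr : r ++ u ∈ shiftLanguage X)
    (hu : u <+: r ++ u) : toFreeGroup r ∈ returnGroup X u := by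
  induction hn : r.length using Nat.strong_induction_on generalizing r with
  | _ n ih =>
    rcases eq_or_ne r [] with rfl | hr₀
    · exact one_mem _
    by_cases h : ∃ p s : List A, p ≠ [] ∧ s ≠ [] ∧ r ++ u = p ++ u ++ s
    · obtain ⟨p, s, hp, hs, h⟩ := h
      have hlen := congrArg List.length h
      have hp' := List.length_pos_iff.2 hp
      have hs' := List.length_pos_iff.2 hs
      simp only [List.length_append] at hlen
      obtain ⟨q, rfl⟩ : p <+: r :=
        List.prefix_of_prefix_length_le (l₃ := r ++ u) ⟨u ++ s, by simp [h]⟩ ⟨u, rfl⟩ (by omega)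
      have hq : q ++ u = u ++ s := by simpa using h
      rw [List.length_append] at hlen hn
      rw [toFreeGroup_append]
      refine mul_mem (ih p.length (by omega) p ?_ ?_ rfl) (ih q.length (by omega) q ?_ ?_ rfl)
      · rw [h] at hr
        exact (mem_shiftLanguage_of_append hr).1
      · exact List.prefix_of_prefix_length_le hu ⟨s, h.symm⟩ (by simp)
      · rw [List.append_assoc] at hr
        exact (mem_shiftLanguage_of_append hr).2
      · exact ⟨s, hq.symm⟩
    · exact Subgroup.subset_closure ⟨r, ⟨hr₀, hr, hu, h⟩, rfl⟩

theorem toFreeGroup_factor_mem_returnGroup {ι : Type} [AddMonoidWithOne ι] {x : ι → A}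
    (hx : language x ⊆ shiftLanguage X) {u : List A} {i : ι} {n : ℕ}
    (h₁ : factor x i u.length = u) (h₂ : factor x (i + n) u.length = u) :
    toFreeGroup (factor x i n) ∈ returnGroup X u := by
  have h : factor x i (n + u.length) = factor x i n ++ u := by rw [factor_add, h₂]
  refine toFreeGroup_mem_returnGroup _ (hx ⟨i, ?_⟩) ⟨factor x (i + u.length) n, ?_⟩
  · rw [List.length_append, length_factor, h]
  · rw [← h, add_comm, factor_add, h₁]

theorem returnGroup_nil (hA : ∀ a : A, [a] ∈ shiftLanguage X) : returnGroup X [] = ⊤ := by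
  rw [eq_top_iff, ← FreeGroup.closure_range_of]
  refine Subgroup.closure_mono ?_
  rintro _ ⟨a, rfl⟩
  refine ⟨[a], ⟨by simp, by simpa using hA a, by simp, ?_⟩, by simp [toFreeGroup]⟩
  rintro ⟨p, s, hp, hs, h⟩
  have := congrArg List.length h
  have := List.length_pos_iff.2 hp
  have := List.length_pos_iff.2 hs
  simp at *
  omega

theorem nil_mem_shiftLanguage (hX : X.Nonempty) : [] ∈ shiftLanguage X := by
  obtain ⟨x, hx⟩ := hX
  exact mem_shiftLanguage.2 ⟨x, hx, 0, rfl⟩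

variable {G : Type v} [Group G]

theorem hasStableReturnGroups_iff (hX : X.Nonempty) (hA : ∀ a : A, [a] ∈ shiftLanguage X)
    (φ : FreeGroup A →* G) :
    HasStableReturnGroups X φ ↔ ∀ u ∈ shiftLanguage X, (returnGroup X u).map φ = φ.range := by
  constructor
  · intro h u hu
    rw [h [] (nil_mem_shiftLanguage hX) rfl u hu List.nil_prefix, returnGroup_nil hA,
      MonoidHom.range_eq_map]
  · intro h w hw _ u hu _
    rw [h u hu, h w hw]

theorem map_eq_range_of_ker_le {F : Type*} {H : Type*} [Group F] [Group H] {φ : F →* G}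
    {ψ : F →* H} (hker : φ.ker ≤ ψ.ker) {R : Subgroup F} (h : R.map φ = φ.range) :
    R.map ψ = ψ.range := by
  refine le_antisymm (Subgroup.map_le_range _ _) ?_
  rintro _ ⟨f, rfl⟩
  obtain ⟨r, hr, hrf⟩ : φ f ∈ R.map φ := h ▸ ⟨f, rfl⟩
  exact ⟨r, hr, ψ.eq_iff.2 (hker (φ.eq_iff.1 hrf))⟩

/-- Taking `k = 1` shows that `g` itself lies in `S`. -/
theorem subgroup_eq_of_subset_leftCoset {S K : Subgroup G} (hSK : S ≤ K) {g : G}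
    (h : ∀ k ∈ K, g⁻¹ * k ∈ S) : S = K := by
  refine le_antisymm hSK fun k hk => ?_
  have h₁ := h 1 K.one_mem
  rw [mul_one] at h₁
  have := S.mul_mem (S.inv_mem h₁) (h k hk)
  rwa [inv_inv, mul_inv_cancel_left] at this

/-- If the return groups have full image in a finite group, then inside a suitable word of the
language the occurrences of `u` hit every element of the image. -/
theorem exists_word_hitting_range [Finite G] {φ : FreeGroup A →* G}
    (h : ∀ v ∈ shiftLanguage X, (returnGroup X v).map φ = φ.range) {u : List A}
    (hu : u ∈ shiftLanguage X) :
    ∃ v ∈ shiftLanguage X, ∀ g ∈ φ.range, ∃ p, p ++ u <+: v ∧ φ (toFreeGroup p) = g := by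
  let D : List A → Set G := fun v => {g | ∃ p, p ++ u <+: v ∧ φ (toFreeGroup p) = g}
  have hbdd : BddAbove ((fun v => (D v).ncard) '' shiftLanguage X) := by
    refine ⟨Nat.card G, ?_⟩
    rintro _ ⟨v, -, rfl⟩
    exact Set.ncard_le_card _
  -- Choose `v₀` realizing the largest number of values, which is at most the order of `G`.
  obtain ⟨v₀, hv₀, hmax₀⟩ := Nat.sSup_mem (Set.image_nonempty.2 ⟨u, hu⟩) hbdd
  have hmax : ∀ v ∈ shiftLanguage X, (D v).ncard ≤ (D v₀).ncard := fun v hv => by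
    have := le_csSup hbdd (Set.mem_image_of_mem _ hv)
    rw [← hmax₀] at this
    exact this
  -- For a return word `r` to `v₀`, both `D v₀` and its translate by `φ r` lie in `D (r ++ v₀)`, and
  -- maximality forces equality.
  have hstab : returnGroup X v₀ ≤ (MulAction.stabilizer G (D v₀)).comap φ := by
    refine (Subgroup.closure_le _).2 ?_
    rintro _ ⟨r, ⟨-, hr, hpre, -⟩, rfl⟩
    have h₁ : D v₀ ⊆ D (r ++ v₀) := fun g ⟨p, hp, hg⟩ => ⟨p, hp.trans hpre, hg⟩
    have h₂ : φ (toFreeGroup r) • D v₀ ⊆ D (r ++ v₀) := by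
      rintro _ ⟨_, ⟨p, hp, rfl⟩, rfl⟩
      refine ⟨r ++ p, ?_, by simp [toFreeGroup_append]⟩
      rw [List.append_assoc]
      exact (List.prefix_append_right_inj r).2 hp
    have h₃ : D v₀ = D (r ++ v₀) := Set.eq_of_subset_of_ncard_le h₁ (hmax _ hr)
    rw [← h₃] at h₂
    exact MulAction.mem_stabilizer_iff.2
      (Set.eq_of_subset_of_ncard_le h₂ (Set.ncard_smul_set _ _).ge)
  obtain ⟨g₀, hg₀⟩ : (D v₀).Nonempty := by
    rw [← Set.ncard_pos]
    refine lt_of_lt_of_le ?_ (hmax u hu)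
    rw [Set.ncard_pos]
    exact ⟨1, [], by simp, by simp [toFreeGroup]⟩
  refine ⟨v₀, hv₀, fun g hg => ?_⟩
  obtain ⟨p₀, -, rfl⟩ := id hg₀
  have hmem : g * (φ (toFreeGroup p₀))⁻¹ ∈ (returnGroup X v₀).map φ := by
    rw [h v₀ hv₀]
    exact mul_mem hg (inv_mem ⟨_, rfl⟩)
  obtain ⟨r, hr, hrg⟩ := hmem
  have hfix := MulAction.mem_stabilizer_iff.1 (hstab hr)
  have : φ r • φ (toFreeGroup p₀) ∈ D v₀ := by
    have := Set.smul_mem_smul_set (a := φ r) hg₀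
    rwa [hfix] at this
  rwa [hrg, smul_eq_mul, inv_mul_cancel_right] at this

end ReturnGroup

/-! ### Full images versus welldoc, for finite targets -/

section Welldoc

variable {A : Type u} {X : Set (ℤ → A)} {G : Type v} [Group G] {φ : FreeGroup A →* G}

theorem image_occ_eq_range [Finite G]
    (h : ∀ v ∈ shiftLanguage X, (returnGroup X v).map φ = φ.range) {x : ℤ → A}
    (hx : language x = shiftLanguage X) {u : List A} (hu : u ∈ language x) :
    φ '' occ x u = Set.range φ := by
  refine Set.Subset.antisymm (Set.image_subset_range _ _) ?_
  rintro _ ⟨f, rfl⟩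
  obtain ⟨v, hv, hv'⟩ := exists_word_hitting_range h (hx ▸ hu)
  rw [← hx] at hv
  obtain ⟨i, hi⟩ := hv
  obtain ⟨p, ⟨s, rfl⟩, hp⟩ := hv' (φ ((freeSegment x 0 i)⁻¹ * f)) ⟨_, rfl⟩
  obtain ⟨h₁, h₂⟩ := factor_append (factor_append hi).1
  refine ⟨_, ⟨i + p.length, h₂, rfl⟩, ?_⟩
  rw [freeSegment_add, h₁, map_mul, hp, ← map_mul, mul_inv_cancel_left]

theorem image_occOneSided_eq_range [Finite G]
    (h : ∀ v ∈ shiftLanguage X, (returnGroup X v).map φ = φ.range) {y : ℕ → A}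
    (hy : language y = shiftLanguage X) {u : List A} (hu : u ∈ language y) :
    φ '' occOneSided y u = Set.range φ := by
  refine Set.Subset.antisymm (Set.image_subset_range _ _) ?_
  rintro _ ⟨f, rfl⟩
  obtain ⟨v, hv, hv'⟩ := exists_word_hitting_range h (hy ▸ hu)
  rw [← hy] at hv
  obtain ⟨i, hi⟩ := hv
  obtain ⟨p, ⟨s, rfl⟩, hp⟩ := hv' (φ ((toFreeGroup (factor y 0 i))⁻¹ * f)) ⟨_, rfl⟩
  obtain ⟨h₁, h₂⟩ := factor_append (factor_append hi).1
  refine ⟨_, ⟨i + p.length, h₂, rfl⟩, ?_⟩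
  have h₁' : factor y (0 + (i : ℕ)) p.length = p := by rw [zero_add]; exact h₁
  have h₃ : factor y 0 (i + p.length) = factor y 0 i ++ p := by
    rw [factor_add, Nat.cast_id, h₁']
  rw [h₃, toFreeGroup_append, map_mul, hp, ← map_mul, mul_inv_cancel_left]

theorem map_returnGroup_eq_range_of_occ {x : ℤ → A} (hx : language x ⊆ shiftLanguage X)
    {u : List A} (hu : u ∈ language x) (h : φ '' occ x u = Set.range φ) :
    (returnGroup X u).map φ = φ.range := by
  obtain ⟨i, hi⟩ := hu
  refine subgroup_eq_of_subset_leftCoset (g := φ (freeSegment x 0 i))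
    (Subgroup.map_le_range _ _) fun k hk => ?_
  obtain ⟨_, ⟨m, hm, rfl⟩, rfl⟩ : k ∈ φ '' occ x u := by rw [h]; exact hk
  rw [← map_inv, ← map_mul]
  refine Subgroup.mem_map_of_mem _ ?_
  rcases le_total i m with him | him
  · obtain ⟨n, rfl⟩ := Int.le.dest him
    rw [freeSegment_add, inv_mul_cancel_left]
    exact toFreeGroup_factor_mem_returnGroup hx hi hm
  · obtain ⟨n, rfl⟩ := Int.le.dest him
    rw [freeSegment_add, mul_inv_rev, inv_mul_cancel_right]
    exact inv_mem (toFreeGroup_factor_mem_returnGroup hx hm hi)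

theorem map_returnGroup_eq_range_of_occOneSided {y : ℕ → A}
    (hy : language y ⊆ shiftLanguage X) {u : List A}
    (h : φ '' occOneSided y u = Set.range φ) :
    (returnGroup X u).map φ = φ.range := by
  have key : ∀ i n : ℕ, factor y i u.length = u → factor y (i + n) u.length = u →
      (toFreeGroup (factor y 0 i))⁻¹ * toFreeGroup (factor y 0 (i + n)) ∈ returnGroup X u := by
    intro i n h₁ h₂
    have h₃ : factor y 0 (i + n) = factor y 0 i ++ factor y i n := by
      rw [factor_add, zero_add, Nat.cast_id]
    rw [h₃, toFreeGroup_append, inv_mul_cancel_left]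
    exact toFreeGroup_factor_mem_returnGroup hy h₁ h₂
  obtain ⟨_, ⟨i, hi, rfl⟩, -⟩ : φ 1 ∈ φ '' occOneSided y u := by rw [h]; exact ⟨1, rfl⟩
  refine subgroup_eq_of_subset_leftCoset (g := φ (toFreeGroup (factor y 0 i)))
    (Subgroup.map_le_range _ _) fun k hk => ?_
  obtain ⟨_, ⟨m, hm, rfl⟩, rfl⟩ : k ∈ φ '' occOneSided y u := by rw [h]; exact hk
  rw [← map_inv, ← map_mul]
  refine Subgroup.mem_map_of_mem _ ?_
  rcases le_total i m with him | him
  · obtain ⟨n, rfl⟩ := Nat.exists_eq_add_of_le him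
    exact key i n hi hm
  · obtain ⟨n, rfl⟩ := Nat.exists_eq_add_of_le him
    rw [← inv_mem_iff, mul_inv_rev, inv_inv]
    exact key m n hm hi

theorem IsMinimalShiftSpace.hasWelldoc_iff [TopologicalSpace A] [DiscreteTopology A] [Finite G]
    (hX : IsMinimalShiftSpace X) :
    HasWelldoc X φ ↔ ∀ u ∈ shiftLanguage X, (returnGroup X u).map φ = φ.range := by
  constructor
  · intro h u hu
    obtain ⟨x, hx⟩ := hX.isShiftSpace.nonempty
    rw [← hX.language_eq hx] at hu
    exact map_returnGroup_eq_range_of_occ (hX.language_eq hx).subset hu (h x hx u hu)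
  · intro h x hx u hu
    exact image_occ_eq_range h (hX.language_eq hx) hu

end Welldoc

/-! ### From all moduli to the abelianization -/

section Abelianization

variable {A : Type u}

theorem ker_ab_le_ker_abMod (k : ℕ) : (ab A).ker ≤ (abMod A k).ker := fun g hg => by
  rw [MonoidHom.mem_ker] at hg ⊢
  rw [abMod, MonoidHom.comp_apply, hg, map_one]

theorem ab_surjective [Finite A] : Function.Surjective (ab A) := by
  classical
  have := Fintype.ofFinite A
  intro z
  have hz : z = ∏ a, Multiplicative.ofAdd (Pi.single a (z.toAdd a)) := by
    rw [← ofAdd_sum, Finset.univ_sum_single, ofAdd_toAdd]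
  rw [hz]
  refine (ab A).range.prod_mem fun a _ => ⟨FreeGroup.of a ^ z.toAdd a, ?_⟩
  rw [map_zpow, ab, FreeGroup.lift_apply_of, ← ofAdd_zsmul, ← Pi.single_smul, smul_eq_mul, mul_one]

theorem abMod_surjective [Finite A] (k : ℕ) : Function.Surjective (abMod A k) := by
  intro z
  obtain ⟨g, hg⟩ := ab_surjective (A := A) (Multiplicative.ofAdd fun a => (z.toAdd a).cast)
  refine ⟨g, Multiplicative.toAdd.injective (funext fun a => ?_)⟩
  rw [abMod_apply, hg]
  simp

/-- The quotient `M ⧸ S` is finitely generated and divisible. Nakayama's lemma for the ideal `(2)`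
yields an odd, hence nonzero, `r` killing it; since each element is a multiple of `|r|`, the
quotient vanishes. -/
theorem eq_top_of_forall_sup_smul_eq_top {M : Type*} [AddCommGroup M] [Module.Finite ℤ M]
    {S : AddSubgroup M} (h : ∀ k : ℕ, 1 ≤ k → ∀ m : M, ∃ s ∈ S, ∃ t : M, m = s + k • t) :
    S = ⊤ := by
  let N := AddSubgroup.toIntSubmodule S
  have hdiv : ∀ k : ℕ, 1 ≤ k → ∀ q : M ⧸ N, ∃ t : M ⧸ N, q = (k : ℤ) • t := by
    intro k hk q
    obtain ⟨m, rfl⟩ := N.mkQ_surjective q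
    obtain ⟨s, hs, t, rfl⟩ := h k hk m
    refine ⟨N.mkQ t, ?_⟩
    have : N.mkQ s = 0 := (Submodule.Quotient.mk_eq_zero N).2 hs
    rw [map_add, this, zero_add, ← map_zsmul, natCast_zsmul]
  obtain ⟨r, hr, hr₀⟩ := Submodule.exists_sub_one_mem_and_smul_eq_zero_of_fg_of_le_smul
    (Ideal.span {(2 : ℤ)}) (⊤ : Submodule ℤ (M ⧸ N)) Module.Finite.fg_top fun q _ => by
      obtain ⟨t, rfl⟩ := hdiv 2 one_le_two q
      exact Submodule.smul_mem_smul (Ideal.mem_span_singleton_self _) trivial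
  have hr₁ : r ≠ 0 := by
    rintro rfl
    have := Ideal.mem_span_singleton.1 hr
    omega
  rw [eq_top_iff]
  intro m _
  obtain ⟨t, ht⟩ := hdiv r.natAbs (by omega) (N.mkQ m)
  refine (Submodule.Quotient.mk_eq_zero N).1 (ht.trans ?_)
  rcases Int.natAbs_eq r with hr' | hr'
  · rw [← hr']
    exact hr₀ t trivial
  · rw [show ((r.natAbs : ℕ) : ℤ) = -r by omega, neg_smul, hr₀ t trivial, neg_zero]

theorem map_ab_eq_range_of_forall_abMod [Finite A] {R : Subgroup (FreeGroup A)}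
    (h : ∀ k : ℕ, 1 ≤ k → R.map (abMod A k) = (abMod A k).range) :
    R.map (ab A) = (ab A).range := by
  have htop : Subgroup.toAddSubgroup' (R.map (ab A)) = ⊤ := by
    refine eq_top_of_forall_sup_smul_eq_top fun k hk m => ?_
    obtain ⟨g, hg⟩ := ab_surjective (A := A) (Multiplicative.ofAdd m)
    obtain ⟨r, hr, hrg⟩ : abMod A k g ∈ R.map (abMod A k) := h k hk ▸ ⟨g, rfl⟩
    have hdvd : ∀ a, ∃ t : ℤ, m a - (ab A r).toAdd a = k * t := fun a => by
      have := congrFun (congrArg Multiplicative.toAdd hrg) a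
      rw [abMod_apply, abMod_apply, hg, ZMod.intCast_eq_intCast_iff_dvd_sub] at this
      exact this
    choose t ht using hdvd
    refine ⟨(ab A r).toAdd, ⟨r, hr, rfl⟩, t, funext fun a => ?_⟩
    have := ht a
    rw [Pi.add_apply, Pi.smul_apply, nsmul_eq_mul]
    linarith
  refine le_antisymm (Subgroup.map_le_range _ _) fun z _ => ?_
  have : z.toAdd ∈ Subgroup.toAddSubgroup' (R.map (ab A)) := htop ▸ trivial
  exact this

end Abelianization

/-! ### Detection by finite quotients -/

section Separability

/-- A finite group has a copy in every universe. -/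
theorem exists_mulEquiv_of_finite (Q : Type v) [Group Q] [Finite Q] :
    ∃ (H : Type w) (_ : Group H) (_ : Finite H), Nonempty (Q ≃* H) := by
  have : Small.{w} Q := Countable.toSmall Q
  exact ⟨Shrink.{w} Q, inferInstance, Finite.of_equiv Q (equivShrink.{w} Q),
    ⟨Shrink.mulEquiv.{w}.symm⟩⟩

/-- An element outside the finitely generated image of `R` would stay outside in some finite `G ⧸
N`, where `R` has full image. The quotient is moved to universe `w`, over which the hypothesis
quantifies. -/
theorem eq_top_of_forall_finite_quotient {F : Type u} [Group F] {G : Type v} [Group G]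
    {φ : F →* G} (hφ : Function.Surjective φ) (hG : IsSubgroupSeparable G) {R : Subgroup F}
    (hR : R.FG)
    (h : ∀ (H : Type w) [Group H] [Finite H] (ψ : F →* H), Function.Surjective ψ →
      φ.ker ≤ ψ.ker → R.map ψ = ψ.range) :
    R.map φ = ⊤ := by
  by_contra hne
  obtain ⟨g, hg⟩ : ∃ g, g ∉ R.map φ := by
    by_contra! hall
    exact hne (eq_top_iff.2 fun g _ => hall g)
  obtain ⟨N, hN, hfin, hgN⟩ := hG (R.map φ) (by
    obtain ⟨T, rfl⟩ := hR
    classical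
    exact ⟨T.image φ, by rw [Finset.coe_image, MonoidHom.map_closure]⟩) g hg
  have : Finite (G ⧸ N) := inferInstance
  obtain ⟨H, _, _, ⟨e⟩⟩ := exists_mulEquiv_of_finite.{v, w} (G ⧸ N)
  let ψ : F →* H := e.toMonoidHom.comp ((QuotientGroup.mk' N).comp φ)
  have hψ : R.map ψ = ψ.range := by
    refine h H ψ (e.surjective.comp ((QuotientGroup.mk'_surjective N).comp hφ)) fun f hf => ?_
    rw [MonoidHom.mem_ker] at hf ⊢
    simp [ψ, hf]
  obtain ⟨f, rfl⟩ := hφ g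
  obtain ⟨r, hr, hrf⟩ : ψ f ∈ R.map ψ := hψ ▸ ⟨f, rfl⟩
  exact hgN ⟨φ r, ⟨r, hr, rfl⟩, e.injective hrf⟩

end Separability

end ReturnGroups

theorem corollary7p5 {A : Type u} [Finite A] [TopologicalSpace A] [DiscreteTopology A]
    (X : Set (ℤ → A)) (hX : IsMinimalShiftSpace X)
    -- every letter of the alphabet occurs in the shift space
    (hA : ∀ a : A, [a] ∈ shiftLanguage X) :
    -- abelian stability is equivalent to the welldoc properties modulo all `k`
    (HasStableReturnGroups X (ab A) ↔ ∀ k : ℕ, 1 ≤ k → HasWelldoc X (abMod A k)) ∧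
    -- it characterizes the original welldoc property of one-sided words
    (∀ y : ℕ → A, language y = shiftLanguage X →
      (HasStableReturnGroups X (ab A) ↔ HasOneSidedWelldoc y)) ∧
    -- the general statement for morphisms onto subgroup separable groups
    (∀ (G : Type v) [Group G] (φ : FreeGroup A →* G), Function.Surjective φ →
      IsSubgroupSeparable G →
      (HasStableReturnGroups X φ ↔
        ∀ (H : Type w) [Group H] [Finite H] (ψ : FreeGroup A →* H), Function.Surjective ψ →
          φ.ker ≤ ψ.ker → HasWelldoc X ψ)) := by
  have hne := hX.isShiftSpace.nonempty
  refine ⟨?_, fun y hy => ?_, fun G _ φ hφ hG => ?_⟩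
  · rw [hasStableReturnGroups_iff hne hA]
    constructor
    · intro h k hk
      have : NeZero k := ⟨by omega⟩
      have : Finite (Multiplicative (A → ZMod k)) := inferInstanceAs (Finite (A → ZMod k))
      exact hX.hasWelldoc_iff.2 fun u hu => map_eq_range_of_ker_le (ker_ab_le_ker_abMod k) (h u hu)
    · intro h u hu
      refine map_ab_eq_range_of_forall_abMod fun k hk => ?_
      have : NeZero k := ⟨by omega⟩
      have : Finite (Multiplicative (A → ZMod k)) := inferInstanceAs (Finite (A → ZMod k))
      exact hX.hasWelldoc_iff.1 (h k hk) u hu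
  · rw [hasStableReturnGroups_iff hne hA]
    constructor
    · intro h k hk u hu
      have : NeZero k := ⟨by omega⟩
      have : Finite (Multiplicative (A → ZMod k)) := inferInstanceAs (Finite (A → ZMod k))
      rw [image_occOneSided_eq_range (fun v hv =>
        map_eq_range_of_ker_le (ker_ab_le_ker_abMod k) (h v hv)) hy hu,
        (abMod_surjective k).range_eq]
    · intro h u hu
      refine map_ab_eq_range_of_forall_abMod fun k hk =>
        map_returnGroup_eq_range_of_occOneSided hy.subset ?_
      rw [h k hk u (hy ▸ hu), (abMod_surjective k).range_eq]
  · rw [hasStableReturnGroups_iff hne hA]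
    constructor
    · intro h H _ _ ψ _ hker
      exact hX.hasWelldoc_iff.2 fun u hu => map_eq_range_of_ker_le hker (h u hu)
    · intro h u hu
      rw [MonoidHom.range_eq_top.2 hφ]
      refine eq_top_of_forall_finite_quotient.{u, v, w} hφ hG ?_
        fun H _ _ ψ hψ hker => hX.hasWelldoc_iff.1 (h H ψ hψ hker) u hu
      -- Finitely many return words generate the return group, so separability applies.
      exact (Subgroup.fg_iff _).2 ⟨_, rfl, (hX.finite_returnWords hu).image _⟩
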